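/- Let $\alpha>0$, let $dA$ be the area measure on $\mathbb C$, and let $d\lambda_\alpha(z)=\frac{\alpha}{\pi}e^{-\alpha|z|^2}\,dA(z)$. Let $F_h^2$ be the harmonic Fock space, i.e. the closed subspace of $L^2(\mathbb C,d\lambda_\alpha)$ consisting of the complex-valued harmonic functions on $\mathbb C$. Let $H_z(w)=e^{\alpha\bar z w}+\overline{e^{\alpha\bar z w}}-1$ be its reproducing kernel, and let $P:L^2(\mathbb C,d\lambda_\alpha)\to F_h^2$ be the orthogonal projection, $(Pg)(z)=\int_{\mathbb C} g(w)\overline{H_z(w)}\,d\lambda_\alpha(w)$. Let $1\le p\le\infty$ and let $\varphi\ge 0$ be a function in $L^p(\mathbb C,dA)$. Then for every $f\in F_h^2$ and $z\in\mathbb C$ the integral $(T_\varphi f)(z)=\int_{\mathbb C}\varphi(w)f(w)\overline{H_z(w)}\,d\lambda_\alpha(w)$ converges absolutely, and $T_\varphi$ is a bounded operator on $F_h^2$ with $T_\varphi f=P(\varphi f)$ whenever $\varphi f\in L^2(\mathbb C,d\lambda_\alpha)$. Moreover $T_\varphi$ belongs to the Schatten class $S_p$ of $F_h^2$. For $p<\infty$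 this means that $T_\varphi$ is compact and its singular values, counted with multiplicity, form a sequence in $\ell^p$, whose $\ell^p$ norm is $\|T_\varphi\|_{S_p}$; and $$\|T_\varphi\|_{S_p}^p\le\frac{2\alpha}{\pi}\int_{\mathbb C}\varphi^p\,dA .$$ For $p=\infty$, $S_\infty$ is the space of all bounded operators on $F_h^2$ with the operator norm, and $\|T_\varphi\|\le\|\varphi\|_\infty$. -/

import Mathlib

open MeasureTheory Set Filter Topology InnerProductSpace
open scoped ENNReal ComplexConjugate

noncomputable section

namespace HarmonicFock

/-- The Gaussian measure `(α / π) e ^ (-α |z|²) dA(z)` on the complex plane. -/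
def gaussianMeasure (α : ℝ) : Measure ℂ :=
  (volume : Measure ℂ).withDensity
    (fun z => ENNReal.ofReal (α / Real.pi * Real.exp (-α * ‖z‖ ^ 2)))

/-- The harmonic Fock space `F_h²`: the classes in `L²` of the Gaussian measure that have a
representative which is a (complex valued) harmonic function on the whole plane. -/
def harmonicFock (α : ℝ) : Submodule ℂ (Lp ℂ 2 (gaussianMeasure α)) where
  carrier := {f | ∃ g : ℂ → ℂ, HarmonicOnNhd g univ ∧ f =ᵐ[gaussianMeasure α] g}
  zero_mem' := ⟨0, harmonicOnNhd_const (0 : ℂ), Lp.coeFn_zero _ _ _⟩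
  add_mem' := by
    rintro f₁ f₂ ⟨g₁, h₁, e₁⟩ ⟨g₂, h₂, e₂⟩
    exact ⟨g₁ + g₂, h₁.add h₂, (Lp.coeFn_add f₁ f₂).trans (e₁.add e₂)⟩
  smul_mem' := by
    rintro c f ⟨g, h, e⟩
    exact ⟨c • g, h.comp_CLM (ContinuousLinearMap.mul ℝ ℂ c),
      (Lp.coeFn_smul c f).trans (e.const_smul c)⟩

theorem harmonic_of_tendsto_real {u : ℕ → ℂ → ℝ} {U : ℂ → ℝ}
    (hu : ∀ n, HarmonicOnNhd (u n) univ)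
    (h : ∀ R : ℝ, TendstoUniformlyOn u U atTop (Metric.closedBall 0 R)) :
    HarmonicOnNhd U univ := by
  have hF : ∀ n, ∃ F : ℂ → ℂ, Differentiable ℂ F ∧ (∀ z, (F z).re = u n z) ∧ (F 0).im = 0 := by
    intro n
    obtain ⟨F, hF, hre⟩ := (hu n).exists_analyticOnNhd_univ_re_eq
    refine ⟨fun z => F z - Complex.I * (F 0).im, ?_, fun z => ?_, by simp⟩
    · have : Differentiable ℂ F := fun z => (hF z (mem_univ z)).differentiableAt
      fun_prop
    · simp [← hre]
  choose F hFd hFre hF0 using hF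
  have hC : ∀ R : ℝ, 0 < R → UniformCauchySeqOn F atTop (Metric.closedBall 0 R) := by
    intro R hR
    have hcu := (h (2 * R)).uniformCauchySeqOn
    rw [Metric.uniformCauchySeqOn_iff] at hcu ⊢
    intro ε hε
    obtain ⟨N, hN⟩ := hcu (ε / 10) (by positivity)
    refine ⟨N, fun m hm n hn z hz => ?_⟩
    have hz' : ‖z‖ ≤ R := by simpa using hz
    have key : ∀ w ∈ Metric.closedBall (0 : ℂ) (2 * R), |u m w - u n w| ≤ ε / 10 := fun w hw => by
      simpa [Real.dist_eq] using (hN m hm n hn w hw).le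
    have h0 : ‖F m 0 - F n 0‖ ≤ ε / 10 := by
      have e : F m 0 - F n 0 = ((u m 0 - u n 0 : ℝ) : ℂ) := by
        apply Complex.ext <;> simp [hFre, hF0]
      rw [e, Complex.norm_real]
      exact key 0 (by simp [hR.le])
    have hb := Complex.borelCaratheodory (f := fun w => F m w - F n w) (M := ε / 10)
      (R := 2 * R) (z := z) (by positivity) ((hFd m).sub (hFd n)).differentiableOn
      (fun w hw => by
        have := key w (Metric.ball_subset_closedBall hw)
        simpa [hFre] using (le_abs_self _).trans this) (by positivity) (by
        simp; linarith)
    have hd : 0 < 2 * R - ‖z‖ := by linarith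
    rw [dist_eq_norm]
    have h1 : 2 * (ε / 10) * ‖z‖ / (2 * R - ‖z‖) ≤ 2 * (ε / 10) := by
      rw [div_le_iff₀ hd]
      nlinarith
    have h2 : ‖F m 0 - F n 0‖ * (2 * R + ‖z‖) / (2 * R - ‖z‖) ≤ 3 * (ε / 10) := by
      rw [div_le_iff₀ hd]
      nlinarith [norm_nonneg z]
    have := hb.trans (add_le_add h1 h2)
    linarith
  have hlim : ∀ z, ∃ l, Tendsto (fun n => F n z) atTop (𝓝 l) := fun z =>
    cauchySeq_tendsto_of_complete
      ((hC (‖z‖ + 1) (by positivity)).cauchySeq (x := z) (by simp))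
  choose G hG using hlim
  have hGd : DifferentiableOn ℂ G univ := by
    refine TendstoLocallyUniformlyOn.differentiableOn (φ := atTop) (F := F) ?_
      (Eventually.of_forall fun n => (hFd n).differentiableOn) isOpen_univ
    refine tendstoLocallyUniformlyOn_of_forall_exists_nhds (fun z _ => ?_)
    refine ⟨Metric.closedBall 0 (‖z‖ + 1), ?_, ?_⟩
    · refine mem_nhdsWithin_of_mem_nhds (Filter.mem_of_superset
        (Metric.isOpen_ball.mem_nhds (x := z) (by simp)) Metric.ball_subset_closedBall)
    · exact (hC _ (by positivity)).tendstoUniformlyOn_of_tendsto fun w _ => hG w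
  have hGU : (fun z => (G z).re) = U := by
    ext z
    have h1 := (Complex.continuous_re.tendsto _).comp (hG z)
    have h2 := (h ‖z‖).tendsto_at (x := z) (by simp)
    refine tendsto_nhds_unique h1 ?_
    simpa [Function.comp_def, hFre] using h2
  intro z _
  rw [← hGU]
  exact (hGd.analyticAt (by simp)).harmonicAt_re

theorem harmonic_of_tendsto {g : ℕ → ℂ → ℂ} {G : ℂ → ℂ}
    (hg : ∀ n, HarmonicOnNhd (g n) univ)
    (h : ∀ R : ℝ, TendstoUniformlyOn g G atTop (Metric.closedBall 0 R)) :
    HarmonicOnNhd G univ := by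
  have h1 : HarmonicOnNhd (fun z => (G z).re) univ :=
    harmonic_of_tendsto_real (u := fun n z => (g n z).re)
      (fun n => (hg n).comp_CLM Complex.reCLM)
      (fun R => Complex.reCLM.uniformContinuous.comp_tendstoUniformlyOn (h R))
  have h2 : HarmonicOnNhd (fun z => (G z).im) univ :=
    harmonic_of_tendsto_real (u := fun n z => (g n z).im)
      (fun n => (hg n).comp_CLM Complex.imCLM)
      (fun R => Complex.imCLM.uniformContinuous.comp_tendstoUniformlyOn (h R))
  have := (h1.comp_CLM Complex.ofRealCLM).add
    (h2.comp_CLM (ContinuousLinearMap.toSpanSingleton ℝ Complex.I))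
  convert this using 1
  ext z
  simp [Complex.re_add_im]

theorem enorm_le_lintegral_circle {g : ℂ → ℂ} (hg : HarmonicOnNhd g univ) (a : ℂ) (r : ℝ) :
    ‖g a‖ₑ ≤ ∫⁻ θ in Ioo (-Real.pi) Real.pi, ‖g (circleMap a r θ)‖ₑ := by
  have h1 : Real.circleAverage g a r = g a := (hg.mono (subset_univ _)).circleAverage_eq
  have h2 : (2 * Real.pi)⁻¹ • ∫ θ in Ioo (-Real.pi) Real.pi, g (circleMap a r θ) = g a := by
    rw [← h1, Real.circleAverage_eq_integral_add (-Real.pi),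
      intervalIntegral.integral_comp_add_right (fun θ => g (circleMap a r θ)),
      ← integral_Ioc_eq_integral_Ioo,
      ← intervalIntegral.integral_of_le (by linarith [Real.pi_pos])]
    congr 2 <;> ring
  rw [← h2, enorm_smul]
  calc _ ≤ 1 * ‖∫ θ in Ioo (-Real.pi) Real.pi, g (circleMap a r θ)‖ₑ := by
        gcongr
        rw [← ofReal_norm, ENNReal.ofReal_le_one, Real.norm_eq_abs,
          abs_of_pos (by positivity)]
        exact inv_le_one_of_one_le₀ (by nlinarith [Real.pi_gt_three])
    _ ≤ _ := by
        rw [one_mul]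
        exact enorm_integral_le_lintegral_enorm _

theorem enorm_le_lintegral_disc {g : ℂ → ℂ} (hg : HarmonicOnNhd g univ) (a : ℂ) :
    ‖g a‖ₑ ≤ 4 * ∫⁻ w in Metric.closedBall a 1, ‖g w‖ₑ := by
  have hgc : Continuous g := continuousOn_univ.1 hg.continuousOn
  set f : ℂ → ℝ≥0∞ := (Metric.closedBall (0 : ℂ) 1).indicator fun w => ‖g (a + w)‖ₑ with hf
  have hfm : Measurable f := by
    refine Measurable.indicator ?_ measurableSet_closedBall
    exact (hgc.comp (by fun_prop)).enorm.measurable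
  have e1 : ∫⁻ w in Metric.closedBall a 1, ‖g w‖ₑ = ∫⁻ w, f w := by
    rw [← lintegral_indicator measurableSet_closedBall, ← lintegral_add_left_eq_self _ a]
    congr 1
    ext w
    simp [hf, indicator, dist_eq_norm]
  have hpm : Measurable fun p : ℝ × ℝ => ENNReal.ofReal p.1 • f (Complex.polarCoord.symm p) := by
    refine Measurable.mul (by fun_prop) (hfm.comp ?_)
    have : (Complex.polarCoord.symm : ℝ × ℝ → ℂ) =
        fun p => (p.1 : ℂ) * (Real.cos p.2 + Real.sin p.2 * Complex.I) :=
      funext Complex.polarCoord_symm_apply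
    rw [this]
    fun_prop
  rw [e1, ← Complex.lintegral_comp_polarCoord_symm, polarCoord_target, Measure.volume_eq_prod,
    ← Measure.prod_restrict, lintegral_prod _ hpm.aemeasurable]
  have e2 : ∫⁻ _ in Ioo (1 / 2 : ℝ) 1, (ENNReal.ofReal (1 / 2)) * ‖g a‖ₑ ≤
      ∫⁻ r in Ioi (0 : ℝ), ∫⁻ θ in Ioo (-Real.pi) Real.pi,
        ENNReal.ofReal (r, θ).1 • f (Complex.polarCoord.symm (r, θ)) := by
    refine le_trans ?_ (lintegral_mono_set (s := Ioo (1 / 2 : ℝ) 1)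
      (fun r hr => lt_trans (by norm_num) hr.1))
    refine setLIntegral_mono' measurableSet_Ioo fun r hr => ?_
    have hr0 : 0 < r := lt_trans (by norm_num) hr.1
    have : ∀ θ : ℝ, ENNReal.ofReal (r, θ).1 • f (Complex.polarCoord.symm (r, θ)) =
        ENNReal.ofReal r * ‖g (circleMap a r θ)‖ₑ := by
      intro θ
      have e : Complex.polarCoord.symm (r, θ) = r * Complex.exp (θ * Complex.I) := by
        rw [Complex.polarCoord_symm_apply, Complex.exp_mul_I]
        simp
      have hm : (r * Complex.exp (θ * Complex.I) : ℂ) ∈ Metric.closedBall (0 : ℂ) 1 := by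
        simp [Complex.norm_exp_ofReal_mul_I, abs_of_pos hr0, hr.2.le]
      rw [e, hf, indicator_of_mem hm, smul_eq_mul, circleMap]
    simp_rw [this]
    rw [lintegral_const_mul _ (by
      exact (hgc.comp (continuous_circleMap a r)).enorm.measurable)]
    gcongr
    · exact hr.1.le
    · exact enorm_le_lintegral_circle hg a r
  calc ‖g a‖ₑ = 4 * ∫⁻ _ in Ioo (1 / 2 : ℝ) 1, (ENNReal.ofReal (1 / 2)) * ‖g a‖ₑ := by
        rw [setLIntegral_const, Real.volume_Ioo, mul_comm (_ * _), ← mul_assoc, ← mul_assoc,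
          mul_assoc 4, ← ENNReal.ofReal_mul (by norm_num),
          ← ENNReal.ofReal_ofNat, ← ENNReal.ofReal_mul (by norm_num)]
        norm_num
    _ ≤ _ := by gcongr

theorem enorm_le_eLpNorm {α : ℝ} (hα : 0 < α) (R : ℝ) :
    ∃ C : ℝ≥0∞, C ≠ ∞ ∧ ∀ g : ℂ → ℂ, HarmonicOnNhd g univ →
      ∀ a ∈ Metric.closedBall (0 : ℂ) R, ‖g a‖ₑ ≤ C * eLpNorm g 2 (gaussianMeasure α) := by
  set B := Metric.closedBall (0 : ℂ) (R + 1) with hB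
  set c : ℝ := α / Real.pi * Real.exp (-α * (R + 1) ^ 2) with hc
  have hcpos : 0 < c := by positivity
  have hle : (volume : Measure ℂ).restrict B ≤ (ENNReal.ofReal c)⁻¹ • gaussianMeasure α := by
    rw [Measure.le_iff]
    intro s hs
    rw [Measure.restrict_apply hs, Measure.smul_apply, smul_eq_mul, gaussianMeasure,
      withDensity_apply _ hs, ← ENNReal.div_eq_inv_mul,
      ENNReal.le_div_iff_mul_le (by simp [hcpos]) (by simp), mul_comm]
    calc ENNReal.ofReal c * volume (s ∩ B) = ∫⁻ _ in s ∩ B, ENNReal.ofReal c := by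
          rw [setLIntegral_const]
      _ ≤ ∫⁻ z in s ∩ B, ENNReal.ofReal (α / Real.pi * Real.exp (-α * ‖z‖ ^ 2)) := by
          refine setLIntegral_mono' (hs.inter measurableSet_closedBall) fun z hz => ?_
          have hz' : ‖z‖ ≤ R + 1 := by simpa [hB] using hz.2
          refine ENNReal.ofReal_le_ofReal ?_
          have : ‖z‖ ^ 2 ≤ (R + 1) ^ 2 := by gcongr
          rw [hc]
          gcongr ?_ * Real.exp ?_
          nlinarith
      _ ≤ _ := lintegral_mono_set inter_subset_left
  refine ⟨4 * ((ENNReal.ofReal c)⁻¹ ^ (1 / (2 : ℝ≥0∞).toReal) *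
    (volume.restrict B univ) ^ (1 / (1 : ℝ≥0∞).toReal - 1 / (2 : ℝ≥0∞).toReal)), ?_, ?_⟩
  · refine ENNReal.mul_ne_top (by simp) (ENNReal.mul_ne_top ?_ ?_)
    · exact ENNReal.rpow_ne_top_of_nonneg (by positivity) (by simp [hcpos])
    · refine ENNReal.rpow_ne_top_of_nonneg (by norm_num) ?_
      rw [Measure.restrict_apply_univ]
      exact measure_closedBall_lt_top.ne
  · intro g hg a ha
    have hgc : Continuous g := continuousOn_univ.1 hg.continuousOn
    have hsub : Metric.closedBall a 1 ⊆ B := by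
      refine Metric.closedBall_subset_closedBall' ?_
      have := Metric.mem_closedBall.1 ha
      linarith
    calc ‖g a‖ₑ ≤ 4 * ∫⁻ w in Metric.closedBall a 1, ‖g w‖ₑ := enorm_le_lintegral_disc hg a
      _ ≤ 4 * ∫⁻ w in B, ‖g w‖ₑ := by gcongr
      _ = 4 * eLpNorm g 1 (volume.restrict B) := by rw [eLpNorm_one_eq_lintegral_enorm]
      _ ≤ 4 * (eLpNorm g 2 (volume.restrict B) *
          (volume.restrict B univ) ^ (1 / (1 : ℝ≥0∞).toReal - 1 / (2 : ℝ≥0∞).toReal)) := by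
          gcongr
          exact eLpNorm_le_eLpNorm_mul_rpow_measure_univ (by norm_num)
            hgc.aestronglyMeasurable
      _ ≤ 4 * (((ENNReal.ofReal c)⁻¹ ^ (1 / (2 : ℝ≥0∞).toReal) *
            eLpNorm g 2 (gaussianMeasure α)) *
          (volume.restrict B univ) ^ (1 / (1 : ℝ≥0∞).toReal - 1 / (2 : ℝ≥0∞).toReal)) := by
          gcongr
          refine (eLpNorm_mono_measure _ hle).trans ?_
          rw [eLpNorm_smul_measure_of_ne_top (by simp)]
          simp
      _ = _ := by ring

theorem isClosed_harmonicFock (α : ℝ) :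
    IsClosed (harmonicFock α : Set (Lp ℂ 2 (gaussianMeasure α))) := by
  rcases le_or_gt α 0 with hα | hα
  · have h0 : gaussianMeasure α = 0 := by
      rw [gaussianMeasure, withDensity_eq_zero_iff (by fun_prop)]
      refine Eventually.of_forall fun z => ENNReal.ofReal_of_nonpos ?_
      exact mul_nonpos_of_nonpos_of_nonneg
        (div_nonpos_of_nonpos_of_nonneg hα Real.pi_pos.le) (Real.exp_pos _).le
    have : (harmonicFock α : Set (Lp ℂ 2 (gaussianMeasure α))) = univ := by
      refine eq_univ_of_forall fun f => ⟨0, harmonicOnNhd_const (0 : ℂ), ?_⟩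
      have hae : ae (gaussianMeasure α) = ⊥ := by rw [h0]; exact ae_zero
      rw [EventuallyEq, hae]
      exact Filter.eventually_bot
    rw [this]
    exact isClosed_univ
  refine isClosed_of_closure_subset fun f hf => ?_
  obtain ⟨u, hu, hlim⟩ := mem_closure_iff_seq_limit.1 hf
  choose g hg hug using hu
  have hC : ∀ R : ℝ, UniformCauchySeqOn g atTop (Metric.closedBall 0 R) := by
    intro R
    obtain ⟨C, hCtop, hC⟩ := enorm_le_eLpNorm hα R
    rw [Metric.uniformCauchySeqOn_iff]
    intro ε hε
    have hcs := hlim.cauchySeq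
    rw [Metric.cauchySeq_iff] at hcs
    obtain ⟨N, hN⟩ := hcs (ε / (C.toReal + 1)) (by positivity)
    refine ⟨N, fun m hm n hn z hz => ?_⟩
    have h1 := hC (g m - g n) ((hg m).sub (hg n)) z hz
    have h2 : eLpNorm (g m - g n) 2 (gaussianMeasure α) = ‖u m - u n‖ₑ := by
      rw [Lp.enorm_def]
      refine eLpNorm_congr_ae ?_
      exact (((hug m).sub (hug n)).symm.trans (Lp.coeFn_sub _ _).symm)
    rw [h2] at h1
    have h3 : ‖g m z - g n z‖ ≤ C.toReal * ‖u m - u n‖ := by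
      have := ENNReal.toReal_mono (ENNReal.mul_ne_top hCtop (by simp)) h1
      simpa [ENNReal.toReal_mul] using this
    have h4 := hN m hm n hn
    rw [dist_eq_norm] at h4 ⊢
    rw [lt_div_iff₀ (by positivity)] at h4
    nlinarith [norm_nonneg (u m - u n), ENNReal.toReal_nonneg (a := C)]
  have hl : ∀ z, ∃ l, Tendsto (fun n => g n z) atTop (𝓝 l) := fun z =>
    cauchySeq_tendsto_of_complete ((hC ‖z‖).cauchySeq (x := z) (by simp))
  choose G hG using hl
  refine ⟨G, harmonic_of_tendsto hg fun R =>
    (hC R).tendstoUniformlyOn_of_tendsto fun w _ => hG w, ?_⟩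
  obtain ⟨ns, hns, hae⟩ := (tendstoInMeasure_of_tendsto_Lp hlim).exists_seq_tendsto_ae
  filter_upwards [hae, ae_all_iff.2 hug] with z hz hz'
  refine tendsto_nhds_unique hz ?_
  simp only [hz']
  exact (hG z).comp hns.tendsto_atTop

instance instCompleteSpaceHarmonicFock (α : ℝ) : CompleteSpace (harmonicFock α) :=
  (isClosed_harmonicFock α).completeSpace_coe

/-- The reproducing kernel `H_z(w)` of `F_h²`, that is `K_z(w) + conj (K_z(w)) - 1`, where
`K_z(w) = exp (α * conj z * w)` is the kernel of the analytic Fock space; the constant `1` is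
subtracted because the constants are both analytic and anti-analytic. -/
def harmonicKernel (α : ℝ) (z w : ℂ) : ℂ :=
  Complex.exp (α * conj z * w) + conj (Complex.exp (α * conj z * w)) - 1

/-- The integral formula `∫ g(w) conj (H_z(w)) dλ_α(w)` of the projection `P`, which extends `P`
beyond `L²` of the Gaussian measure. -/
def projIntegral (α : ℝ) (g : ℂ → ℂ) (z : ℂ) : ℂ :=
  ∫ w, g w * conj (harmonicKernel α z w) ∂(gaussianMeasure α)

/-- `T` is the Toeplitz operator `T_φ = P M_φ` on `F_h²`. For every `f` in `F_h²`, `T f` is given by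
the (absolutely convergent) integral formula of `P` applied to `φ f`, and it is the orthogonal
projection of `φ f` whenever `φ f` is square integrable for the Gaussian measure.
The integral formula alone determines `T`. -/
structure IsToeplitz (α : ℝ) (φ : ℂ → ℝ) (T : harmonicFock α →L[ℂ] harmonicFock α) : Prop where
  integrable : ∀ (f : harmonicFock α) (z : ℂ),
    Integrable (fun w => φ w * f.1 w * conj (harmonicKernel α z w)) (gaussianMeasure α)
  eq_integral : ∀ f : harmonicFock α,
    (T f).1 =ᵐ[gaussianMeasure α] projIntegral α (fun w => φ w * f.1 w)
  eq_proj : ∀ (f : harmonicFock α) (h : MemLp (fun w => φ w * f.1 w) 2 (gaussianMeasure α)),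
    T f = (harmonicFock α).orthogonalProjectionOnto (h.toLp (fun w => φ w * f.1 w))

end HarmonicFock

namespace Schatten

variable {H : Type*} [NormedAddCommGroup H] [InnerProductSpace ℂ H] [CompleteSpace H]

/-- The multiplicity of `s > 0` as a singular value of `T`, that is, the dimension of the
eigenspace of `T* T` for the eigenvalue `s²` (equivalently, of `|T|` for the eigenvalue `s`).
It is finite when `T` is compact. -/
def singularMultiplicity (T : H →L[ℂ] H) (s : ℝ) : ℕ :=
  Module.finrank ℂ (Module.End.eigenspace
    ((ContinuousLinearMap.adjoint T ∘L T : H →L[ℂ] H) : Module.End ℂ H) ((s ^ 2 : ℝ) : ℂ))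

/-- The Schatten norm: for `p < ∞` and compact `T`, the `ℓ^p` norm of the singular values of `T`,
counted with multiplicity, and for `p = ∞` the operator norm. For `p < ∞` an operator that
is not compact has Schatten norm `∞`. -/
def schattenNorm (p : ℝ≥0∞) (T : H →L[ℂ] H) : ℝ≥0∞ :=
  open Classical in
  if p = ∞ then ‖T‖ₑ
  else if IsCompactOperator T then
    (∑' s : {s : ℝ // 0 < s},
      (singularMultiplicity T s : ℝ≥0∞) * ENNReal.ofReal (s : ℝ) ^ p.toReal) ^ (1 / p.toReal)
  else ∞

/-- Membership in the Schatten class `S_p`: for `p < ∞` the compact operators whose singular value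
sequence is in `ℓ^p`, for `p = ∞` all bounded operators. -/
def MemSchatten (p : ℝ≥0∞) (T : H →L[ℂ] H) : Prop :=
  schattenNorm p T < ∞

end Schatten

end

/-! The Toeplitz operator factors as `T = M* M`, where `M` multiplies by `√φ` and maps the harmonic
Fock space into `L²`. This defines `T` even when `φ f` is not square integrable, and makes it
positive. If `e_i` are orthonormal eigenvectors of `T`, the singular values are `s_i = ‖M e_i‖² = ∫
φ |e_i|² dλ`.

Two estimates give the bound. Since `|e_i|² dλ` is a probability measure, Jensen gives `s_i ^ p ≤ ∫
φ ^ p |e_i|² dλ`. By Bessel's inequality for the reproducing kernel, `∑ |e_i(z)|² ≤ ‖H_z‖² = H_z(z)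
≤ 2 e ^ (α |z|²)`, and this exponential cancels the Gaussian density, leaving `(2α/π) ∫ φ ^ p dA`.
Both estimates hold for every finite orthonormal family, not only for eigenvectors. So the single
bound on `∑ ‖M e_i‖ ^ (2p)` yields boundedness of `M` (families of one vector), its compactness
(`isCompactOperator_of_sum_le`) and the Schatten norm (`tsum_singularMultiplicity_le`), with no
interpolation. For `p = ∞` one has `‖T‖ = ‖M‖² ≤ ‖φ‖_∞`.

The remaining input is the reproducing property. A harmonic `g` in `L²` is `F + conj G` with `F`,
`G` entire and again in `L²`, and each part is reproduced by a translation and the mean value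
property. -/

namespace Schatten

/-! ### Compactness and singular values from sums over orthonormal families -/

variable {H L : Type*} [NormedAddCommGroup H] [InnerProductSpace ℂ H]
  [NormedAddCommGroup L] [InnerProductSpace ℂ L]

/-- If the sums of `‖M e‖ ^ q` over finite orthonormal families are bounded, then `M` is small on
the orthogonal complement of a finite dimensional subspace. -/
theorem exists_finiteDimensional_norm_le {M : H →L[ℂ] L} {q : ℝ} (hq : 0 < q) {C : ℝ≥0∞}
    (hC : C ≠ ∞)
    (h : ∀ (n : ℕ) (e : Fin n → H), Orthonormal ℂ e → ∑ i, ‖M (e i)‖ₑ ^ q ≤ C)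
    {ε : ℝ} (hε : 0 < ε) :
    ∃ K : Submodule ℂ H, FiniteDimensional ℂ K ∧ ∀ x ∈ Kᗮ, ‖M x‖ ≤ ε * ‖x‖ := by
  let S : Set ℕ := {n | ∃ e : Fin n → H, Orthonormal ℂ e ∧ ∀ i, ε ≤ ‖M (e i)‖}
  have hS0 : S.Nonempty := ⟨0, Fin.elim0, ⟨fun i => i.elim0, fun i => i.elim0⟩, fun i => i.elim0⟩
  have hεq0 : ENNReal.ofReal ε ^ q ≠ 0 := by
    simp [ENNReal.rpow_eq_zero_iff, hε]
  have hεq1 : ENNReal.ofReal ε ^ q ≠ ∞ := ENNReal.rpow_ne_top_of_nonneg hq.le (by simp)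
  have hSb : BddAbove S := by
    refine ⟨⌊(C / ENNReal.ofReal ε ^ q).toReal⌋₊, ?_⟩
    rintro n ⟨e, he, hle⟩
    have h1 : (n : ℝ≥0∞) * ENNReal.ofReal ε ^ q ≤ C := by
      refine le_trans ?_ (h n e he)
      calc (n : ℝ≥0∞) * ENNReal.ofReal ε ^ q = ∑ _i : Fin n, ENNReal.ofReal ε ^ q := by simp
        _ ≤ _ := by
          refine Finset.sum_le_sum fun i _ => ?_
          gcongr
          rw [← ofReal_norm]
          exact ENNReal.ofReal_le_ofReal (hle i)
    rw [← ENNReal.le_div_iff_mul_le (by simp [hεq0]) (by simp [hεq1])] at h1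
    refine Nat.le_floor ?_
    have := ENNReal.toReal_mono (ENNReal.div_ne_top hC hεq0) h1
    simpa using this
  -- Take a family of maximal length. A vector orthogonal to its span violating the bound would,
  -- once normalised, extend the family.
  obtain ⟨e, he, hle⟩ := Nat.sSup_mem hS0 hSb
  refine ⟨Submodule.span ℂ (range e), FiniteDimensional.span_of_finite ℂ (finite_range e), ?_⟩
  intro x hx
  by_contra! hlt
  have hx0 : x ≠ 0 := by rintro rfl; simp at hlt
  have hxn : 0 < ‖x‖ := norm_pos_iff.2 hx0
  have hmem : sSup S + 1 ∈ S := by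
    refine ⟨Matrix.vecCons ((‖x‖⁻¹ : ℂ) • x) e, ?_, ?_⟩
    · rw [orthonormal_vecCons_iff]
      refine ⟨by simp [norm_smul, hxn.ne'], fun i => ?_, he⟩
      rw [inner_smul_left, Submodule.inner_left_of_mem_orthogonal
        (Submodule.subset_span (mem_range_self i)) hx, mul_zero]
    · intro i
      refine Fin.cases ?_ (fun j => ?_) i
      · simp only [Matrix.cons_val_zero, map_smul, norm_smul]
        rw [norm_inv, Complex.norm_real, norm_norm, inv_mul_eq_div, le_div_iff₀ hxn]
        exact hlt.le
      · simpa using hle j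
  have := le_csSup hSb hmem
  omega

/-- Compact operators are norm closed, and `M` is within `ε / 2` of its composition with the
projection onto a finite dimensional `K`. -/
theorem isCompactOperator_of_sum_le [CompleteSpace L] {M : H →L[ℂ] L} {q : ℝ} (hq : 0 < q)
    {C : ℝ≥0∞} (hC : C ≠ ∞)
    (h : ∀ (n : ℕ) (e : Fin n → H), Orthonormal ℂ e → ∑ i, ‖M (e i)‖ₑ ^ q ≤ C) :
    IsCompactOperator M := by
  have hcl : IsClosed {f : H →L[ℂ] L | IsCompactOperator f} :=
    isClosed_setOfPred_isCompactOperator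
  refine hcl.closure_subset (Metric.mem_closure_iff.2 fun ε hε => ?_)
  obtain ⟨K, hK, hMK⟩ := exists_finiteDimensional_norm_le hq hC h (half_pos hε)
  refine ⟨(M ∘L K.subtypeL) ∘L K.orthogonalProjectionOnto, ?_, ?_⟩
  · exact (isCompactOperator_of_locallyCompactSpace_rng (M ∘L K.subtypeL)).comp_clm _
  · rw [dist_eq_norm]
    refine lt_of_le_of_lt (ContinuousLinearMap.opNorm_le_bound _ (half_pos hε).le fun x => ?_)
      (half_lt_self hε)
    have e : (M - (M ∘L K.subtypeL) ∘L K.orthogonalProjectionOnto) x =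
        M (x - K.orthogonalProjectionOnto x) := by simp
    rw [e]
    refine (hMK _ (K.sub_starProjection_mem_orthogonal x)).trans ?_
    gcongr
    have h1 := Submodule.norm_sq_eq_add_norm_sq_starProjection x K
    have h2 : x - K.starProjection x = Kᗮ.starProjection x := by
      rw [Submodule.starProjection_orthogonal_val]
    rw [h2]
    nlinarith [sq_nonneg ‖K.starProjection x‖, norm_nonneg x, norm_nonneg (Kᗮ.starProjection x)]

/-- In infinite dimension `finrank` is `0` and the empty family serves, so eigenspaces need not be
shown finite dimensional before they are used. -/
theorem exists_orthonormal_fin_finrank (E : Submodule ℂ H) :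
    ∃ v : Fin (Module.finrank ℂ E) → E, Orthonormal ℂ v := by
  by_cases h : Module.finrank ℂ E = 0
  · rw [h]
    exact ⟨Fin.elim0, fun i => i.elim0, fun i => i.elim0⟩
  · have : FiniteDimensional ℂ E := Module.finite_of_finrank_pos (Nat.pos_of_ne_zero h)
    exact ⟨_, (stdOrthonormalBasis ℂ E).orthonormal⟩

variable [CompleteSpace H]

/-- For a positive operator, an eigenvector of `T* T` for `s²` is an eigenvector of `T` for `s`. -/
theorem apply_eq_smul_of_mem_eigenspace {T : H →L[ℂ] H} (hT : T.IsPositive) {s : ℝ} (hs : 0 < s)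
    {x : H} (hx : x ∈ Module.End.eigenspace
      ((ContinuousLinearMap.adjoint T ∘L T : H →L[ℂ] H) : Module.End ℂ H) ((s ^ 2 : ℝ) : ℂ)) :
    T x = (s : ℂ) • x := by
  rw [Module.End.mem_eigenspace_iff] at hx
  have hTT : T (T x) = ((s ^ 2 : ℝ) : ℂ) • x := by
    have := hT.isSelfAdjoint.adjoint_eq
    rw [this] at hx
    exact hx
  -- The defect `y` satisfies `T y = -s y`; as `T` is positive and `s > 0`, it vanishes.
  set y := T x - (s : ℂ) • x with hy
  have hTy : T y = -(s : ℂ) • y := by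
    rw [hy, map_sub, map_smul, hTT, smul_sub, smul_smul]
    push_cast
    rw [sq, neg_smul, neg_mul, neg_smul]
    abel
  have h0 := hT.re_inner_nonneg_right y
  rw [hTy, inner_smul_right, inner_self_eq_norm_sq_to_K] at h0
  have h1 : 0 ≤ -(s * ‖y‖ ^ 2) := by
    have e : (-(s : ℂ) * ((‖y‖ : ℝ) : ℂ) ^ 2) = ((-(s * ‖y‖ ^ 2) : ℝ) : ℂ) := by push_cast; ring
    have h0' : 0 ≤ (-(s : ℂ) * ((‖y‖ : ℝ) : ℂ) ^ 2).re := h0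
    rwa [e, Complex.ofReal_re] at h0'
  have h2 : ‖y‖ ^ 2 ≤ 0 := by
    by_contra! h
    nlinarith [mul_pos hs h]
  have h3 : y = 0 := by
    rw [← norm_eq_zero]
    exact pow_eq_zero_iff (two_ne_zero) |>.1 (le_antisymm h2 (sq_nonneg _))
  exact sub_eq_zero.1 h3

/-- Eigenspaces of `T* T` for distinct `s²` are orthogonal, so their orthonormal bases join into one
orthonormal family. A unit vector `v` of the eigenspace for `s²` has `‖M v‖² = ⟨v, T v⟩ = s`, so
each partial sum is a sum bounded by `h`. -/
theorem tsum_singularMultiplicity_le [CompleteSpace L] {M : H →L[ℂ] L} {p : ℝ} {C : ℝ≥0∞}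
    (h : ∀ (n : ℕ) (e : Fin n → H), Orthonormal ℂ e → ∑ i, ‖M (e i)‖ₑ ^ (2 * p) ≤ C) :
    ∑' s : {s : ℝ // 0 < s},
      (singularMultiplicity (ContinuousLinearMap.adjoint M ∘L M) s : ℝ≥0∞) *
        ENNReal.ofReal (s : ℝ) ^ p ≤ C := by
  set T : H →L[ℂ] H := ContinuousLinearMap.adjoint M ∘L M
  have hT : T.IsPositive := ContinuousLinearMap.isPositive_adjoint_comp_self M
  rw [ENNReal.tsum_eq_iSup_sum]
  refine iSup_le fun S => ?_
  set A : Module.End ℂ H := ((ContinuousLinearMap.adjoint T ∘L T : H →L[ℂ] H) : Module.End ℂ H)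
  have hA : A.IsSymmetric :=
    (ContinuousLinearMap.isPositive_adjoint_comp_self T).isSymmetric
  let E : S → Submodule ℂ H := fun s => Module.End.eigenspace A (((s : ℝ) ^ 2 : ℝ) : ℂ)
  have hinj : Function.Injective fun s : S => ((((s : {s : ℝ // 0 < s}) : ℝ) ^ 2 : ℝ) : ℂ) := by
    intro s t hst
    have h1 : ((s : {s : ℝ // 0 < s}) : ℝ) ^ 2 = ((t : {s : ℝ // 0 < s}) : ℝ) ^ 2 := by
      exact Complex.ofReal_injective hst
    rw [sq_eq_sq₀ s.1.2.le t.1.2.le] at h1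
    exact Subtype.ext (Subtype.ext h1)
  have hfam := hA.orthogonalFamily_eigenspaces.comp hinj
  choose v hv using fun s : S => exists_orthonormal_fin_finrank (E s)
  have horth := hfam.orthonormal_sigma_orthonormal hv
  let e := Fintype.equivFin (Σ s : S, Fin (Module.finrank ℂ (E s)))
  have key := h _ _ (horth.comp e.symm e.symm.injective)
  refine le_trans (le_of_eq ?_) key
  refine Eq.trans ?_ (e.symm.sum_comp (fun a : Σ s : S, Fin (Module.finrank ℂ (E s)) =>
    ‖M (v a.1 a.2 : H)‖ₑ ^ (2 * p))).symm
  rw [Fintype.sum_sigma, ← Finset.sum_coe_sort]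
  refine Finset.sum_congr rfl fun s _ => ?_
  have hval : ∀ i, ‖M (v s i : H)‖ₑ ^ (2 * p) = ENNReal.ofReal (s : ℝ) ^ p := by
    intro i
    have h1 : T (v s i) = ((s : ℝ) : ℂ) • (v s i : H) :=
      apply_eq_smul_of_mem_eigenspace hT s.1.2 (v s i).2
    have h2 : ‖M (v s i)‖ ^ 2 = s := by
      have := ContinuousLinearMap.apply_norm_sq_eq_inner_adjoint_right M (v s i : H)
      rw [this]
      change RCLike.re (inner ℂ (v s i : H) (T (v s i))) = _
      rw [h1, inner_smul_right, inner_self_eq_norm_sq_to_K]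
      have : ‖(v s i : H)‖ = 1 := (hv s).1 i
      simp [this]
    rw [ENNReal.rpow_mul, ← h2, ENNReal.ofReal_pow (norm_nonneg _), ofReal_norm]
    norm_num
  simp_rw [hval]
  rw [Finset.sum_const, Finset.card_univ, Fintype.card_fin, nsmul_eq_mul]
  rfl

end Schatten


/-! ### The Gaussian measure: polar coordinates and mean values -/

namespace HarmonicFock

/-- The density of the Gaussian measure. -/
noncomputable def gaussianDensity (α : ℝ) (z : ℂ) : ℝ := α / Real.pi * Real.exp (-α * ‖z‖ ^ 2)

variable {α : ℝ}

theorem continuous_gaussianDensity : Continuous (gaussianDensity α) := by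
  unfold gaussianDensity
  fun_prop

theorem gaussianDensity_pos (hα : 0 < α) (z : ℂ) : 0 < gaussianDensity α z := by
  unfold gaussianDensity
  positivity

theorem gaussianMeasure_eq : gaussianMeasure α =
    (volume : Measure ℂ).withDensity fun z => ENNReal.ofReal (gaussianDensity α z) := rfl

theorem absolutelyContinuous_gaussianMeasure : gaussianMeasure α ≪ volume :=
  withDensity_absolutelyContinuous _ _

theorem integral_gaussianMeasure {E : Type*} [NormedAddCommGroup E] [NormedSpace ℝ E]
    (hα : 0 < α) (f : ℂ → E) :
    ∫ w, f w ∂(gaussianMeasure α) = ∫ w, gaussianDensity α w • f w := by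
  rw [gaussianMeasure_eq, integral_withDensity_eq_integral_toReal_smul
    continuous_gaussianDensity.measurable.ennreal_ofReal (by simp)]
  simp_rw [ENNReal.toReal_ofReal (gaussianDensity_pos hα _).le]

theorem integrable_gaussianMeasure_iff {f : ℂ → ℂ} (hα : 0 < α) :
    Integrable f (gaussianMeasure α) ↔ Integrable fun w => gaussianDensity α w • f w := by
  rw [gaussianMeasure_eq, integrable_withDensity_iff_integrable_smul'
    continuous_gaussianDensity.measurable.ennreal_ofReal (by simp)]
  simp_rw [ENNReal.toReal_ofReal (gaussianDensity_pos hα _).le]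

theorem isProbabilityMeasure_gaussianMeasure (hα : 0 < α) :
    IsProbabilityMeasure (gaussianMeasure α) := by
  have h1 : ∫ w, gaussianDensity α w = 1 := by
    have := GaussianFourier.integral_rexp_neg_mul_sq_norm (V := ℂ) hα
    unfold gaussianDensity
    rw [integral_const_mul, this, Complex.finrank_real_complex]
    have := Real.pi_pos
    norm_num
    field_simp
  constructor
  rw [gaussianMeasure_eq, withDensity_apply _ MeasurableSet.univ, Measure.restrict_univ,
    ← ofReal_integral_eq_lintegral_ofReal
      (Integrable.of_integral_ne_zero (by rw [h1]; exact one_ne_zero))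
      (Eventually.of_forall fun z => (gaussianDensity_pos hα z).le), h1, ENNReal.ofReal_one]

theorem circleAverage_eq_integral_Ioo {E : Type*} [NormedAddCommGroup E] [NormedSpace ℝ E]
    (f : ℂ → E) (c : ℂ) (R : ℝ) : Real.circleAverage f c R =
      (2 * Real.pi)⁻¹ • ∫ θ in Ioo (-Real.pi) Real.pi, f (circleMap c R θ) := by
  rw [Real.circleAverage_eq_integral_add (-Real.pi),
    intervalIntegral.integral_comp_add_right (fun θ => f (circleMap c R θ)),
    ← integral_Ioc_eq_integral_Ioo,
    ← intervalIntegral.integral_of_le (by linarith [Real.pi_pos])]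
  congr 2 <;> ring

theorem polarCoord_symm_eq_circleMap (p : ℝ × ℝ) :
    Complex.polarCoord.symm p = circleMap 0 p.1 p.2 := by
  rw [Complex.polarCoord_symm_apply, circleMap_zero, Complex.exp_mul_I]
  simp

theorem gaussianDensity_circleMap (r θ : ℝ) :
    gaussianDensity α (circleMap 0 r θ) = gaussianDensity α r := by
  simp [gaussianDensity]

theorem continuous_circleMap_zero_uncurry : Continuous fun p : ℝ × ℝ => circleMap 0 p.1 p.2 := by
  unfold circleMap
  fun_prop

/-- The Gaussian integral in polar coordinates. -/
theorem lintegral_gaussianMeasure_polar {f : ℂ → ℝ≥0∞} (hf : Measurable f) :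
    ∫⁻ z, f z ∂(gaussianMeasure α) = ∫⁻ r in Ioi (0 : ℝ),
      ENNReal.ofReal r * ENNReal.ofReal (gaussianDensity α r) *
        ∫⁻ θ in Ioo (-Real.pi) Real.pi, f (circleMap 0 r θ) := by
  have hd := (continuous_gaussianDensity (α := α)).measurable.ennreal_ofReal
  rw [gaussianMeasure_eq, lintegral_withDensity_eq_lintegral_mul _ hd hf,
    ← Complex.lintegral_comp_polarCoord_symm, polarCoord_target, Measure.volume_eq_prod,
    ← Measure.prod_restrict, lintegral_prod]
  · refine lintegral_congr fun r => ?_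
    have hfr : Measurable fun θ => f (circleMap 0 r θ) :=
      hf.comp (continuous_circleMap 0 r).measurable
    rw [← lintegral_const_mul _ hfr]
    refine lintegral_congr fun θ => ?_
    simp only [polarCoord_symm_eq_circleMap, Pi.mul_apply, gaussianDensity_circleMap, smul_eq_mul,
      mul_assoc]
  · simp_rw [polarCoord_symm_eq_circleMap]
    refine Measurable.aemeasurable (Measurable.mul (by fun_prop) ?_)
    exact (hd.mul hf).comp continuous_circleMap_zero_uncurry.measurable

/-- The density is radial, so integrals can be compared one circle at a time. -/
theorem lintegral_gaussianMeasure_mono_of_circleAverage {u v : ℂ → ℝ} (hu : Continuous u)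
    (hv : Continuous v) (hu0 : ∀ z, 0 ≤ u z) (hv0 : ∀ z, 0 ≤ v z)
    (h : ∀ r, 0 < r → Real.circleAverage u 0 r ≤ Real.circleAverage v 0 r) :
    ∫⁻ z, ENNReal.ofReal (u z) ∂(gaussianMeasure α) ≤
      ∫⁻ z, ENNReal.ofReal (v z) ∂(gaussianMeasure α) := by
  rw [lintegral_gaussianMeasure_polar hu.measurable.ennreal_ofReal,
    lintegral_gaussianMeasure_polar hv.measurable.ennreal_ofReal]
  refine setLIntegral_mono' measurableSet_Ioi fun r hr => ?_
  have key : ∀ {f : ℂ → ℝ}, Continuous f → (∀ z, 0 ≤ f z) →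
      ∫⁻ θ in Ioo (-Real.pi) Real.pi, ENNReal.ofReal (f (circleMap 0 r θ)) =
        ENNReal.ofReal (∫ θ in Ioo (-Real.pi) Real.pi, f (circleMap 0 r θ)) := by
    intro f hf hf0
    rw [ofReal_integral_eq_lintegral_ofReal]
    · exact ((hf.comp (continuous_circleMap 0 r)).integrableOn_Icc).mono_set Ioo_subset_Icc_self
    · exact Eventually.of_forall fun θ => hf0 _
  rw [key hu hu0, key hv hv0]
  have := h r hr
  rw [circleAverage_eq_integral_Ioo, circleAverage_eq_integral_Ioo, smul_eq_mul, smul_eq_mul,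
    mul_le_mul_iff_right₀ (by positivity)] at this
  gcongr

/-- The mean value property of harmonic functions with respect to the Gaussian measure. -/
theorem integral_gaussianMeasure_harmonic (hα : 0 < α) {h : ℂ → ℂ} (hh : HarmonicOnNhd h univ)
    (hi : Integrable h (gaussianMeasure α)) : ∫ w, h w ∂(gaussianMeasure α) = h 0 := by
  -- The radial factor does not depend on `g`; the case `g = 1` shows that it is `1`, so it is never
  -- computed.
  have polar : ∀ g : ℂ → ℂ, HarmonicOnNhd g univ → Integrable g (gaussianMeasure α) →
      ∫ w, g w ∂(gaussianMeasure α) =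
        (∫ r in Ioi (0 : ℝ), ((r * gaussianDensity α r * (2 * Real.pi) : ℝ) : ℂ)) * g 0 := by
    intro g hg hgi
    have hgc : Continuous g := continuousOn_univ.1 hg.continuousOn
    rw [integrable_gaussianMeasure_iff hα] at hgi
    have hmeas : Continuous fun p : ℝ × ℝ =>
        p.1 • (gaussianDensity α (circleMap 0 p.1 p.2) • g (circleMap 0 p.1 p.2)) := by
      have h1 := (continuous_gaussianDensity (α := α)).comp continuous_circleMap_zero_uncurry
      have h2 := hgc.comp continuous_circleMap_zero_uncurry
      exact continuous_fst.smul (h1.smul h2)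
    have hint : Integrable (fun p : ℝ × ℝ =>
        p.1 • (gaussianDensity α (circleMap 0 p.1 p.2) • g (circleMap 0 p.1 p.2)))
        ((volume.restrict (Ioi (0 : ℝ))).prod (volume.restrict (Ioo (-Real.pi) Real.pi))) := by
      refine ⟨hmeas.aestronglyMeasurable, ?_⟩
      rw [Measure.prod_restrict, ← Measure.volume_eq_prod, ← polarCoord_target]
      have := hgi.2
      rw [HasFiniteIntegral, ← Complex.lintegral_comp_polarCoord_symm] at this
      refine lt_of_le_of_lt (le_of_eq ?_) this
      refine setLIntegral_congr_fun polarCoord.open_target.measurableSet fun p hp => ?_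
      have hp1 : 0 < p.1 := hp.1
      simp only [polarCoord_symm_eq_circleMap]
      rw [enorm_smul, Real.enorm_of_nonneg hp1.le, smul_eq_mul]
    rw [integral_gaussianMeasure hα, ← Complex.integral_comp_polarCoord_symm, polarCoord_target,
      Measure.volume_eq_prod, ← Measure.prod_restrict]
    simp_rw [polarCoord_symm_eq_circleMap]
    rw [integral_prod _ hint, ← integral_mul_const]
    refine integral_congr_ae (Eventually.of_forall fun r => ?_)
    simp only [gaussianDensity_circleMap, integral_smul]
    have h1 : Real.circleAverage g 0 r = g 0 := (hg.mono (subset_univ _)).circleAverage_eq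
    rw [circleAverage_eq_integral_Ioo, inv_smul_eq_iff₀ (by positivity)] at h1
    rw [h1]
    simp only [Complex.real_smul]
    push_cast
    ring
  have hprob := isProbabilityMeasure_gaussianMeasure hα
  have h1 := polar (fun _ => 1) (harmonicOnNhd_const (1 : ℂ)) (integrable_const _)
  rw [integral_const, probReal_univ, one_smul, mul_one] at h1
  rw [polar h hh hi, ← h1, one_mul]

/-- Translating by `z` completes the square: density times conjugate kernel becomes the density at
`w` times `exp (-α conj z w)`. The integrand is again entire, with value `F z` at the centre. -/
theorem integral_gaussianMeasure_entire_mul_exp (hα : 0 < α) {F : ℂ → ℂ} (hF : Differentiable ℂ F)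
    (z : ℂ) (hi : Integrable (fun w => F w * conj (Complex.exp (α * conj z * w)))
      (gaussianMeasure α)) :
    ∫ w, F w * conj (Complex.exp (α * conj z * w)) ∂(gaussianMeasure α) = F z := by
  have key : ∀ w, gaussianDensity α (w + z) •
      (F (w + z) * conj (Complex.exp (α * conj z * (w + z)))) =
      gaussianDensity α w • (F (w + z) * Complex.exp (-(α * conj z * w))) := by
    intro w
    simp only [gaussianDensity, Complex.real_smul]
    push_cast
    rw [← Complex.exp_conj]
    have e : Complex.exp (-α * (‖w + z‖ : ℂ) ^ 2) * Complex.exp (conj (α * conj z * (w + z))) =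
        Complex.exp (-α * (‖w‖ : ℂ) ^ 2) * Complex.exp (-(α * conj z * w)) := by
      rw [← Complex.exp_add, ← Complex.exp_add, ← Complex.mul_conj', ← Complex.mul_conj']
      congr 1
      simp only [map_mul, map_add, Complex.conj_ofReal, Complex.conj_conj]
      ring
    linear_combination (α / Real.pi * F (w + z)) * e
  rw [integrable_gaussianMeasure_iff hα] at hi
  have hi' := hi.comp_add_right z
  simp_rw [key] at hi'
  rw [integral_gaussianMeasure hα, ← integral_add_right_eq_self _ z]
  simp_rw [key]
  rw [← integral_gaussianMeasure hα, integral_gaussianMeasure_harmonic hα]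
  · simp
  · have : Differentiable ℂ fun w => F (w + z) * Complex.exp (-(α * conj z * w)) := by fun_prop
    exact fun w _ => (this.analyticAt w).harmonicAt
  · exact (integrable_gaussianMeasure_iff hα).2 hi'

/-! ### Entire decomposition and the reproducing property -/

/-- With `A`, `B` entire, `Re A = Re g` and `Re B = Im g`, one has `g = (A + iB)/2 + conj ((A -
iB)/2)`. A constant is moved between the summands to get `G 0 = 0`. -/
theorem exists_entire_add_conj {g : ℂ → ℂ} (hg : HarmonicOnNhd g univ) :
    ∃ F G : ℂ → ℂ, Differentiable ℂ F ∧ Differentiable ℂ G ∧ G 0 = 0 ∧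
      ∀ z, g z = F z + conj (G z) := by
  obtain ⟨A, hA, hAre⟩ := (hg.comp_CLM Complex.reCLM).exists_analyticOnNhd_univ_re_eq
  obtain ⟨B, hB, hBre⟩ := (hg.comp_CLM Complex.imCLM).exists_analyticOnNhd_univ_re_eq
  have hA' : Differentiable ℂ A := fun z => (hA z (mem_univ z)).differentiableAt
  have hB' : Differentiable ℂ B := fun z => (hB z (mem_univ z)).differentiableAt
  set G : ℂ → ℂ := fun z => (A z - Complex.I * B z) / 2
  refine ⟨fun z => (A z + Complex.I * B z) / 2 + conj (G 0), fun z => G z - G 0, by fun_prop,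
    by fun_prop, by simp, fun z => ?_⟩
  have h1 : (A z).re = (g z).re := congrFun hAre z
  have h2 : (B z).re = (g z).im := congrFun hBre z
  have e1 : (A z + conj (A z)) = 2 * ((g z).re : ℂ) := by rw [Complex.add_conj, h1]; simp
  have e2 : (B z + conj (B z)) = 2 * ((g z).im : ℂ) := by rw [Complex.add_conj, h2]; simp
  have e3 := Complex.re_add_im (g z)
  simp only [G, map_sub, map_div₀, map_mul, Complex.conj_I, map_ofNat]
  linear_combination -e3 - e1 / 2 - Complex.I * e2 / 2

/-- On circles about `0` the cross term `2 Re (F G)` of `|F + conj G|²` averages to its value at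
`0`, which is zero because `G 0 = 0`. Hence the average of `|F|²` is at most that of `|F + conj
G|²`. -/
theorem memLp_two_entire_of_add_conj {F G : ℂ → ℂ} (hF : Differentiable ℂ F)
    (hG : Differentiable ℂ G) (hG0 : G 0 = 0)
    (h : MemLp (fun z => F z + conj (G z)) 2 (gaussianMeasure α)) :
    MemLp F 2 (gaussianMeasure α) := by
  refine ⟨hF.continuous.aestronglyMeasurable, lt_of_le_of_lt ?_ h.2⟩
  have hGc : Continuous fun z => conj (G z) := Complex.continuous_conj.comp hG.continuous
  rw [eLpNorm_eq_lintegral_rpow_enorm_toReal (by norm_num) (by norm_num),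
    eLpNorm_eq_lintegral_rpow_enorm_toReal (by norm_num) (by norm_num)]
  gcongr 1
  have conv : ∀ x : ℂ, ‖x‖ₑ ^ (2 : ℝ≥0∞).toReal = ENNReal.ofReal (‖x‖ ^ 2) := by
    intro x
    rw [ENNReal.ofReal_pow (norm_nonneg _), ofReal_norm]
    norm_num
  simp_rw [conv]
  refine lintegral_gaussianMeasure_mono_of_circleAverage (hF.continuous.norm.pow 2)
    ((hF.continuous.add hGc).norm.pow 2) (fun z => by positivity) (fun z => by positivity)
    fun r _ => ?_
  have hFG : HarmonicOnNhd (fun z => (F z * G z).re) univ := fun z _ =>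
    ((hF.mul hG).analyticAt z).harmonicAt_re
  have h0 : Real.circleAverage (fun z => (F z * G z).re) 0 r = 0 := by
    rw [(hFG.mono (subset_univ _)).circleAverage_eq, hG0]
    simp
  have ci : ∀ {f : ℂ → ℝ}, Continuous f → CircleIntegrable f 0 r := fun hf =>
    hf.continuousOn.circleIntegrable'
  have hFGc : Continuous fun z => (F z * G z).re :=
    Complex.continuous_re.comp (hF.mul hG).continuous
  have e1 : (fun z => ‖F z + conj (G z)‖ ^ 2) =
      ((fun z => ‖F z‖ ^ 2) + fun z => ‖G z‖ ^ 2) + (2 : ℝ) • fun z => (F z * G z).re := by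
    ext z
    have := Complex.normSq_add (F z) (conj (G z))
    simp only [Complex.normSq_eq_norm_sq, Complex.conj_conj, RCLike.norm_conj] at this
    simpa using this
  rw [e1, Real.circleAverage_add, Real.circleAverage_add, Real.circleAverage_smul, h0, smul_zero,
    add_zero, le_add_iff_nonneg_right]
  · exact Real.circleAverage_nonneg_of_nonneg fun z _ => by positivity
  · exact ci (hF.continuous.norm.pow 2)
  · exact ci (hG.continuous.norm.pow 2)
  · exact ci ((hF.continuous.norm.pow 2).add (hG.continuous.norm.pow 2))
  · exact ci (hFGc.const_smul _)

theorem memLp_two_exp (hα : 0 < α) (c : ℂ) :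
    MemLp (fun w => Complex.exp (c * w)) 2 (gaussianMeasure α) := by
  have hc : Continuous fun w => Complex.exp (c * w) := by fun_prop
  rw [memLp_two_iff_integrable_sq_norm hc.aestronglyMeasurable, gaussianMeasure_eq,
    integrable_withDensity_iff_integrable_smul'
      continuous_gaussianDensity.measurable.ennreal_ofReal (by simp)]
  have h1 := (GaussianFourier.integrable_cexp_neg_mul_sq_norm_add (V := ℂ) (b := α)
    (by simpa using hα) 2 (conj c)).norm.const_mul (α / Real.pi)
  refine h1.congr (Eventually.of_forall fun w => ?_)
  have e : (2 * inner ℝ (conj c) w : ℝ) = 2 * (c * w).re := by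
    rw [Complex.inner, Complex.conj_conj, mul_comm w c]
  have e2 : (-(α : ℂ) * (‖w‖ : ℂ) ^ 2 + 2 * ((inner ℝ (conj c) w : ℝ) : ℂ)) =
    ((-α * ‖w‖ ^ 2 + 2 * inner ℝ (conj c) w : ℝ) : ℂ) := by push_cast; ring
  beta_reduce
  rw [ENNReal.toReal_ofReal (gaussianDensity_pos hα _).le]
  simp only [Complex.norm_exp, smul_eq_mul, gaussianDensity]
  rw [e2, Complex.ofReal_re, e, Real.exp_add, ← Real.exp_nat_mul]
  push_cast
  ring

theorem memLp_two_harmonicKernel (hα : 0 < α) (z : ℂ) :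
    MemLp (harmonicKernel α z) 2 (gaussianMeasure α) := by
  have := isProbabilityMeasure_gaussianMeasure hα
  exact ((memLp_two_exp hα _).add (memLp_two_exp hα _).star).sub (memLp_const 1)

theorem conj_harmonicKernel (z w : ℂ) : conj (harmonicKernel α z w) = harmonicKernel α z w := by
  simp only [harmonicKernel, map_sub, map_add, Complex.conj_conj, map_one]
  ring

/-- The reproducing property of the kernel `H_z`. -/
theorem integral_mul_harmonicKernel (hα : 0 < α) {g : ℂ → ℂ} (hg : HarmonicOnNhd g univ)
    (hg2 : MemLp g 2 (gaussianMeasure α)) (z : ℂ) :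
    ∫ w, g w * harmonicKernel α z w ∂(gaussianMeasure α) = g z := by
  have hprob := isProbabilityMeasure_gaussianMeasure hα
  obtain ⟨F, G, hF, hG, hG0, hgFG⟩ := exists_entire_add_conj hg
  have hgeq : g = fun z => F z + conj (G z) := funext hgFG
  have hF2 : MemLp F 2 (gaussianMeasure α) :=
    memLp_two_entire_of_add_conj hF hG hG0 (hgeq ▸ hg2)
  have hG2 : MemLp G 2 (gaussianMeasure α) := by
    have := (hg2.sub hF2).star
    convert this using 1
    ext z
    simp [hgFG]
  set K : ℂ → ℂ := fun w => Complex.exp (α * conj z * w) with hK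
  have hKd : Differentiable ℂ K := by fun_prop
  have hK2 : MemLp K 2 (gaussianMeasure α) := memLp_two_exp hα _
  have iFK : Integrable (fun w => F w * conj (K w)) (gaussianMeasure α) :=
    hF2.integrable_mul hK2.star
  have iGK : Integrable (fun w => G w * conj (K w)) (gaussianMeasure α) :=
    hG2.integrable_mul hK2.star
  have iFK' : Integrable (fun w => F w * (K w - 1)) (gaussianMeasure α) :=
    hF2.integrable_mul (hK2.sub (memLp_const 1))
  have iGK' : Integrable (fun w => G w * (K w - 1)) (gaussianMeasure α) :=
    hG2.integrable_mul (hK2.sub (memLp_const 1))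
  have harm : ∀ {f : ℂ → ℂ}, Differentiable ℂ f → HarmonicOnNhd f univ := fun hf w _ =>
    (hf.analyticAt w).harmonicAt
  have I1 : ∫ w, F w * conj (K w) ∂(gaussianMeasure α) = F z :=
    integral_gaussianMeasure_entire_mul_exp hα hF z iFK
  have I2 : ∫ w, G w * conj (K w) ∂(gaussianMeasure α) = G z :=
    integral_gaussianMeasure_entire_mul_exp hα hG z iGK
  -- Since `K 0 = 1`, the factor `K - 1` makes this entire integrand vanish at `0`: `F` sees only
  -- the `conj K` part of `H_z`. The same holds for `G` after conjugation.
  have I3 : ∫ w, F w * (K w - 1) ∂(gaussianMeasure α) = 0 := by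
    rw [integral_gaussianMeasure_harmonic hα (harm (by fun_prop)) iFK']
    simp [hK]
  have I4 : ∫ w, G w * (K w - 1) ∂(gaussianMeasure α) = 0 := by
    rw [integral_gaussianMeasure_harmonic hα (harm (by fun_prop)) iGK']
    simp [hK]
  have e : ∀ w, g w * harmonicKernel α z w = (F w * conj (K w) + F w * (K w - 1)) +
      conj (G w * conj (K w) + G w * (K w - 1)) := by
    intro w
    rw [hgFG, harmonicKernel]
    simp only [hK, map_add, map_mul, map_sub, map_one, Complex.conj_conj]
    ring
  simp_rw [e]
  have s1 : Integrable (fun w => F w * conj (K w) + F w * (K w - 1)) (gaussianMeasure α) :=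
    iFK.add iFK'
  have s2 : Integrable (fun w => conj (G w * conj (K w) + G w * (K w - 1))) (gaussianMeasure α) :=
    (memLp_one_iff_integrable.2 (iGK.add iGK')).star.integrable le_rfl
  rw [integral_add s1 s2, integral_add iFK iFK', integral_conj, integral_add iGK iGK',
    I1, I2, I3, I4, hgFG, add_zero, add_zero]

end HarmonicFock


/-! ### Kernel vectors and the trace estimate -/

namespace HarmonicFock

variable {α : ℝ}

theorem harmonicOnNhd_harmonicKernel (z : ℂ) : HarmonicOnNhd (harmonicKernel α z) univ := by
  have h : Differentiable ℂ fun w => Complex.exp (α * conj z * w) := by fun_prop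
  intro w _
  exact ((h.analyticAt w).harmonicAt.add (h.analyticAt w).harmonicAt_conj).sub
    (harmonicOnNhd_const (1 : ℂ) (s := univ) w (mem_univ w))

/-- The reproducing kernel as an element of the harmonic Fock space. -/
noncomputable def kernelVector (hα : 0 < α) (z : ℂ) : harmonicFock α :=
  ⟨(memLp_two_harmonicKernel hα z).toLp _,
    harmonicKernel α z, harmonicOnNhd_harmonicKernel z,
    (memLp_two_harmonicKernel hα z).coeFn_toLp⟩

theorem coeFn_kernelVector (hα : 0 < α) (z : ℂ) :
    (kernelVector hα z).1 =ᵐ[gaussianMeasure α] harmonicKernel α z :=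
  (memLp_two_harmonicKernel hα z).coeFn_toLp

theorem inner_kernelVector (hα : 0 < α) (z : ℂ) {f : harmonicFock α} {g : ℂ → ℂ}
    (hg : HarmonicOnNhd g univ) (hfg : f.1 =ᵐ[gaussianMeasure α] g) :
    inner ℂ (kernelVector hα z) f = g z := by
  rw [← integral_mul_harmonicKernel hα hg ((memLp_congr_ae hfg).1 (Lp.memLp f.1)) z,
    Submodule.coe_inner, L2.inner_def]
  refine integral_congr_ae ?_
  filter_upwards [hfg, coeFn_kernelVector hα z] with w h1 h2
  rw [h1, h2, RCLike.inner_apply, conj_harmonicKernel]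

theorem ae_eq_inner_kernelVector (hα : 0 < α) (f : harmonicFock α) :
    f.1 =ᵐ[gaussianMeasure α] fun z => inner ℂ (kernelVector hα z) f := by
  obtain ⟨g, hg, hfg⟩ := f.2
  filter_upwards [hfg] with z hz
  rw [hz, inner_kernelVector hα z hg hfg]

/-- The reproducing property gives `‖H_z‖² = H_z(z) = 2 e ^ (α |z|²) - 1`. Dropping the `-1` leaves
a multiple of the reciprocal of the Gaussian density. -/
theorem norm_kernelVector_sq_le (hα : 0 < α) (z : ℂ) :
    ‖kernelVector hα z‖ ^ 2 ≤ 2 * Real.exp (α * ‖z‖ ^ 2) := by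
  have h := inner_kernelVector hα z (harmonicOnNhd_harmonicKernel z) (coeFn_kernelVector hα z)
  replace h := (inner_self_eq_norm_sq_to_K (𝕜 := ℂ) (kernelVector hα z)).symm.trans h
  have h2 : harmonicKernel α z z = ((2 * Real.exp (α * ‖z‖ ^ 2) - 1 : ℝ) : ℂ) := by
    have e : (α * conj z * z : ℂ) = ((α * ‖z‖ ^ 2 : ℝ) : ℂ) := by
      push_cast
      rw [← Complex.conj_mul']
      ring
    rw [harmonicKernel, e, ← Complex.ofReal_exp, Complex.conj_ofReal]
    push_cast
    ring
  rw [h2] at h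
  have h3 : ‖kernelVector hα z‖ ^ 2 = 2 * Real.exp (α * ‖z‖ ^ 2) - 1 :=
    Complex.ofReal_injective (by rw [← h]; push_cast; rfl)
  linarith

/-- Bessel's inequality for the vector `H_z`, whose inner products with the `e i` are their values
at `z` up to conjugation. -/
theorem sum_enorm_sq_le (hα : 0 < α) {n : ℕ} {e : Fin n → harmonicFock α}
    (he : Orthonormal ℂ e) :
    ∀ᵐ z ∂(gaussianMeasure α),
      ∑ i, ‖(e i).1 z‖ₑ ^ 2 ≤ ENNReal.ofReal (2 * Real.exp (α * ‖z‖ ^ 2)) := by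
  filter_upwards [ae_all_iff.2 fun i => ae_eq_inner_kernelVector hα (e i)] with z hz
  have h := (he.sum_inner_products_le (kernelVector hα z) (s := Finset.univ)).trans
    (norm_kernelVector_sq_le hα z)
  refine le_trans (le_of_eq ?_) (ENNReal.ofReal_le_ofReal h)
  rw [ENNReal.ofReal_sum_of_nonneg fun i _ => by positivity]
  refine Finset.sum_congr rfl fun i _ => ?_
  rw [hz i, ENNReal.ofReal_pow (norm_nonneg _), norm_inner_symm, ofReal_norm]

/-- The trace estimate: the diagonal of the reproducing kernel is at most `2 e ^ (α |z|²)`. -/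
theorem sum_lintegral_mul_enorm_sq_le (hα : 0 < α) {ψ : ℂ → ℝ≥0∞} (hψ : AEMeasurable ψ)
    {n : ℕ} {e : Fin n → harmonicFock α} (he : Orthonormal ℂ e) :
    ∑ i, ∫⁻ z, ψ z * ‖(e i).1 z‖ₑ ^ 2 ∂(gaussianMeasure α) ≤
      ENNReal.ofReal (2 * α / Real.pi) * ∫⁻ z, ψ z := by
  have hψ' : AEMeasurable ψ (gaussianMeasure α) :=
    hψ.mono_ac absolutelyContinuous_gaussianMeasure
  have hm : ∀ i ∈ Finset.univ,
      AEMeasurable (fun z => ψ z * ‖(e i).1 z‖ₑ ^ 2) (gaussianMeasure α) := fun i _ =>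
    hψ'.mul ((Lp.aestronglyMeasurable (e i).1).enorm.pow_const 2)
  rw [← lintegral_finsetSum' _ hm]
  calc ∫⁻ z, ∑ i, ψ z * ‖(e i).1 z‖ₑ ^ 2 ∂(gaussianMeasure α)
      ≤ ∫⁻ z, ψ z * ENNReal.ofReal (2 * Real.exp (α * ‖z‖ ^ 2)) ∂(gaussianMeasure α) := by
        refine lintegral_mono_ae ?_
        filter_upwards [sum_enorm_sq_le hα he] with z hz
        rw [← Finset.mul_sum]
        gcongr
    -- The exponentials cancel: `(α/π) e ^ (-α |z|²) * 2 e ^ (α |z|²) = 2α/π`.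
    _ = ∫⁻ z, ENNReal.ofReal (2 * α / Real.pi) * ψ z := by
        have hc : Continuous fun z : ℂ => 2 * Real.exp (α * ‖z‖ ^ 2) := by fun_prop
        have hm2 : AEMeasurable fun z => ψ z * ENNReal.ofReal (2 * Real.exp (α * ‖z‖ ^ 2)) :=
          hψ.mul hc.measurable.ennreal_ofReal.aemeasurable
        rw [gaussianMeasure_eq, lintegral_withDensity_eq_lintegral_mul₀
          continuous_gaussianDensity.measurable.ennreal_ofReal.aemeasurable hm2]
        refine lintegral_congr fun z => ?_
        rw [Pi.mul_apply, mul_left_comm, ← ENNReal.ofReal_mul (gaussianDensity_pos hα z).le,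
          mul_comm]
        congr 2
        rw [gaussianDensity, neg_mul, Real.exp_neg]
        field_simp
    _ = _ := lintegral_const_mul'' _ hψ

/-! ### Jensen's inequality for the measures `|f|² dλ` -/

theorem eLpNorm_two_sq_eq_lintegral {μ : Measure ℂ} (f : ℂ → ℂ) :
    eLpNorm f 2 μ ^ 2 = ∫⁻ z, ‖f z‖ₑ ^ 2 ∂μ := by
  have := eLpNorm_nnreal_pow_eq_lintegral (f := f) (μ := μ) (p := 2) two_ne_zero
  simp only [NNReal.coe_ofNat, ENNReal.rpow_ofNat, ENNReal.coe_ofNat] at this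
  exact this

theorem enorm_sq_eq_lintegral {μ : Measure ℂ} (f : Lp ℂ 2 μ) :
    ‖f‖ₑ ^ 2 = ∫⁻ z, ‖f z‖ₑ ^ 2 ∂μ := by
  rw [Lp.enorm_def, eLpNorm_two_sq_eq_lintegral]

/-- The probability measure `|f|² dλ` of a unit vector `f`. -/
theorem isProbabilityMeasure_withDensity_enorm_sq {μ : Measure ℂ} {f : Lp ℂ 2 μ} (hf : ‖f‖ = 1) :
    IsProbabilityMeasure (μ.withDensity fun z => ‖f z‖ₑ ^ 2) := by
  constructor
  rw [withDensity_apply _ MeasurableSet.univ, Measure.restrict_univ, ← enorm_sq_eq_lintegral,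
    ← ofReal_norm, hf]
  simp

theorem lintegral_withDensity_enorm_sq {μ : Measure ℂ} (f : Lp ℂ 2 μ) {ψ : ℂ → ℝ≥0∞}
    (hψ : AEMeasurable ψ μ) :
    ∫⁻ z, ψ z ∂(μ.withDensity fun z => ‖f z‖ₑ ^ 2) = ∫⁻ z, ψ z * ‖f z‖ₑ ^ 2 ∂μ := by
  rw [lintegral_withDensity_eq_lintegral_mul₀
    ((Lp.aestronglyMeasurable f).enorm.pow_const 2) hψ]
  simp_rw [Pi.mul_apply, mul_comm]

/-- This is Jensen's inequality in the form `L¹ ≤ L^p` on a probability space, which also covers `p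
= ∞`. -/
theorem lintegral_mul_enorm_sq_le_eLpNorm {μ : Measure ℂ} {f : Lp ℂ 2 μ} (hf : ‖f‖ = 1)
    {φ : ℂ → ℝ} (hφ : AEStronglyMeasurable φ μ) {p : ℝ≥0∞} (hp : 1 ≤ p) :
    ∫⁻ z, ‖φ z‖ₑ * ‖f z‖ₑ ^ 2 ∂μ ≤ eLpNorm φ p (μ.withDensity fun z => ‖f z‖ₑ ^ 2) := by
  have := isProbabilityMeasure_withDensity_enorm_sq hf
  rw [← lintegral_withDensity_enorm_sq f hφ.enorm, ← eLpNorm_one_eq_lintegral_enorm]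
  exact eLpNorm_le_eLpNorm_of_exponent_le hp (hφ.mono_ac (withDensity_absolutelyContinuous _ _))

theorem lintegral_mul_enorm_sq_rpow_le {μ : Measure ℂ} {f : Lp ℂ 2 μ} (hf : ‖f‖ = 1)
    {φ : ℂ → ℝ} (hφ : AEStronglyMeasurable φ μ) {p : ℝ≥0∞} (hp : 1 ≤ p) (hp' : p ≠ ∞) :
    (∫⁻ z, ‖φ z‖ₑ * ‖f z‖ₑ ^ 2 ∂μ) ^ p.toReal ≤
      ∫⁻ z, ‖φ z‖ₑ ^ p.toReal * ‖f z‖ₑ ^ 2 ∂μ := by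
  have hp0 : p ≠ 0 := (zero_lt_one.trans_le hp).ne'
  have hpr : 0 < p.toReal := ENNReal.toReal_pos hp0 hp'
  have h := lintegral_mul_enorm_sq_le_eLpNorm hf hφ hp
  rw [eLpNorm_eq_lintegral_rpow_enorm_toReal hp0 hp', one_div, ENNReal.le_rpow_inv_iff hpr,
    lintegral_withDensity_enorm_sq f (hφ.enorm.pow_const _)] at h
  exact h

/-! ### The factorisation `T = M* M` -/

/-- Multiplication by `√φ` from the harmonic Fock space to `L²`. -/
theorem exists_sqrt_mul_operator {φ : ℂ → ℝ}
    (hφ0 : ∀ᵐ z ∂(gaussianMeasure α), 0 ≤ φ z) (hφ : AEStronglyMeasurable φ (gaussianMeasure α))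
    {A : ℝ≥0∞} (hA : A ≠ ∞)
    (h : ∀ f : harmonicFock α, ‖f‖ = 1 →
      ∫⁻ z, ‖φ z‖ₑ * ‖f.1 z‖ₑ ^ 2 ∂(gaussianMeasure α) ≤ A) :
    ∃ M : harmonicFock α →L[ℂ] Lp ℂ 2 (gaussianMeasure α),
      (∀ f, M f =ᵐ[gaussianMeasure α] fun z => (√(φ z) : ℂ) * f.1 z) ∧
      (∀ f, ‖M f‖ₑ ^ 2 = ∫⁻ z, ‖φ z‖ₑ * ‖f.1 z‖ₑ ^ 2 ∂(gaussianMeasure α)) ∧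
      ENNReal.ofReal (‖M‖ ^ 2) ≤ A := by
  -- Both sides are homogeneous of degree two, so unit vectors suffice.
  have hA' : ∀ f : harmonicFock α,
      ∫⁻ z, ‖φ z‖ₑ * ‖f.1 z‖ₑ ^ 2 ∂(gaussianMeasure α) ≤ A * ‖f‖ₑ ^ 2 := by
    intro f
    rcases eq_or_ne f 0 with rfl | hf
    · have : ∀ᵐ z ∂(gaussianMeasure α), ‖φ z‖ₑ * ‖(0 : harmonicFock α).1 z‖ₑ ^ 2 = 0 := by
        filter_upwards [Lp.coeFn_zero ℂ 2 (gaussianMeasure α)] with z hz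
        rw [Submodule.coe_zero, hz]
        simp
      rw [lintegral_congr_ae this]
      simp
    have hn : 0 < ‖f‖ := norm_pos_iff.2 hf
    have h1 := h ((‖f‖⁻¹ : ℂ) • f) (by
      rw [norm_smul, norm_inv, Complex.norm_real, norm_norm, inv_mul_cancel₀ hn.ne'])
    have h2 : ∫⁻ z, ‖φ z‖ₑ * ‖f.1 z‖ₑ ^ 2 ∂(gaussianMeasure α) =
        ‖f‖ₑ ^ 2 * ∫⁻ z, ‖φ z‖ₑ * ‖((‖f‖⁻¹ : ℂ) • f).1 z‖ₑ ^ 2 ∂(gaussianMeasure α) := by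
      rw [← lintegral_const_mul' _ _ (by simp)]
      refine lintegral_congr_ae ?_
      filter_upwards [Lp.coeFn_smul (‖f‖⁻¹ : ℂ) f.1] with z hz
      have e : f.1 z = (‖f‖ : ℂ) * ((‖f‖⁻¹ : ℂ) • f).1 z := by
        change _ = (‖f‖ : ℂ) * ((‖f‖⁻¹ : ℂ) • f.1 : Lp ℂ 2 (gaussianMeasure α)) z
        rw [hz, Pi.smul_apply, smul_eq_mul, mul_inv_cancel_left₀]
        exact_mod_cast hn.ne'
      conv_lhs => rw [e, enorm_mul, mul_pow]
      rw [← ofReal_norm (‖f‖ : ℂ), Complex.norm_real, norm_norm, ofReal_norm]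
      ring
    rw [h2, mul_comm]
    gcongr
  have hs : AEStronglyMeasurable (fun z => ((√(φ z) : ℝ) : ℂ)) (gaussianMeasure α) :=
    (Complex.continuous_ofReal.comp Real.continuous_sqrt).comp_aestronglyMeasurable hφ
  have hse : ∀ᵐ z ∂(gaussianMeasure α), ∀ x : ℂ,
      ‖((√(φ z) : ℝ) : ℂ) * x‖ₑ ^ 2 = ‖φ z‖ₑ * ‖x‖ₑ ^ 2 := by
    filter_upwards [hφ0] with z hz x
    rw [enorm_mul, mul_pow, ← ofReal_norm ((√(φ z) : ℝ) : ℂ), Complex.norm_real,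
      ← ENNReal.ofReal_pow (norm_nonneg _), Real.norm_eq_abs, sq_abs, Real.sq_sqrt hz,
      Real.enorm_of_nonneg hz]
  have hmem : ∀ f : harmonicFock α,
      MemLp (fun z => ((√(φ z) : ℝ) : ℂ) * f.1 z) 2 (gaussianMeasure α) := by
    intro f
    refine ⟨hs.mul (Lp.aestronglyMeasurable f.1), ?_⟩
    have e2 : eLpNorm (fun z => ((√(φ z) : ℝ) : ℂ) * f.1 z) 2 (gaussianMeasure α) ^ 2 =
        ∫⁻ z, ‖φ z‖ₑ * ‖f.1 z‖ₑ ^ 2 ∂(gaussianMeasure α) := by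
      rw [← lintegral_congr_ae (hse.mono fun z hz => hz (f.1 z)), eLpNorm_two_sq_eq_lintegral]
    have h3 := (hA' f).trans_lt (ENNReal.mul_lt_top hA.lt_top (by simp))
    rw [← e2] at h3
    exact (ENNReal.pow_lt_top_iff.1 h3).resolve_right two_ne_zero
  let M₀ : harmonicFock α →ₗ[ℂ] Lp ℂ 2 (gaussianMeasure α) :=
    { toFun := fun f => (hmem f).toLp _
      map_add' := by
        intro f g
        rw [← MemLp.toLp_add]
        refine MemLp.toLp_congr _ _ ?_
        filter_upwards [Lp.coeFn_add f.1 g.1] with z hz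
        rw [Submodule.coe_add, hz]
        simp [mul_add]
      map_smul' := by
        intro c f
        rw [RingHom.id_apply, ← MemLp.toLp_const_smul]
        refine MemLp.toLp_congr _ _ ?_
        filter_upwards [Lp.coeFn_smul c f.1] with z hz
        rw [Submodule.coe_smul, hz]
        simp [mul_left_comm] }
  have hM₀ : ∀ f, M₀ f =ᵐ[gaussianMeasure α] fun z => (√(φ z) : ℂ) * f.1 z :=
    fun f => (hmem f).coeFn_toLp
  have hM₀n : ∀ f, ‖M₀ f‖ₑ ^ 2 = ∫⁻ z, ‖φ z‖ₑ * ‖f.1 z‖ₑ ^ 2 ∂(gaussianMeasure α) := by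
    intro f
    rw [enorm_sq_eq_lintegral]
    refine lintegral_congr_ae ?_
    filter_upwards [hM₀ f, hse] with z h1 h2
    rw [h1, h2]
  have hbound : ∀ f, ‖M₀ f‖ ≤ √A.toReal * ‖f‖ := by
    intro f
    have h1 := hA' f
    rw [← hM₀n] at h1
    have h2 := ENNReal.toReal_mono (ENNReal.mul_ne_top hA (by simp)) h1
    simp only [ENNReal.toReal_pow, ENNReal.toReal_mul, toReal_enorm] at h2
    rw [← Real.sqrt_sq (norm_nonneg f), ← Real.sqrt_mul ENNReal.toReal_nonneg]
    exact Real.le_sqrt_of_sq_le h2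
  refine ⟨M₀.mkContinuous _ hbound, hM₀, hM₀n, ?_⟩
  refine ENNReal.ofReal_le_of_le_toReal ?_
  have := M₀.mkContinuous_norm_le (Real.sqrt_nonneg _) hbound
  calc ‖M₀.mkContinuous _ hbound‖ ^ 2 ≤ √A.toReal ^ 2 := by gcongr
    _ = A.toReal := Real.sq_sqrt ENNReal.toReal_nonneg

/-- `M* M` represents the form `∫ φ f conj g dλ`. Taking `g = H_z` gives the integral formula,
absolutely convergent as a product of the `L²` functions `√φ f` and `√φ H_z`. Letting `g` range over
the whole space identifies the orthogonal projection. -/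
theorem isToeplitz_adjoint_comp_self (hα : 0 < α) {φ : ℂ → ℝ}
    (hφ0 : ∀ᵐ z ∂(gaussianMeasure α), 0 ≤ φ z)
    {M : harmonicFock α →L[ℂ] Lp ℂ 2 (gaussianMeasure α)}
    (hM : ∀ f, M f =ᵐ[gaussianMeasure α] fun z => (√(φ z) : ℂ) * f.1 z) :
    IsToeplitz α φ (ContinuousLinearMap.adjoint M ∘L M) := by
  have hprod : ∀ f g : harmonicFock α, (fun w => φ w * f.1 w * conj (g.1 w))
      =ᵐ[gaussianMeasure α] fun w => inner ℂ (M g w) (M f w) := by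
    intro f g
    filter_upwards [hM f, hM g, hφ0] with w h1 h2 h0
    rw [h1, h2, RCLike.inner_apply, map_mul, Complex.conj_ofReal]
    have : (φ w : ℂ) = (√(φ w) : ℂ) * (√(φ w) : ℂ) := by
      rw [← Complex.ofReal_mul, Real.mul_self_sqrt h0]
    rw [this]
    ring
  have hinner : ∀ f g : harmonicFock α,
      inner ℂ g ((ContinuousLinearMap.adjoint M ∘L M) f) =
        ∫ w, φ w * f.1 w * conj (g.1 w) ∂(gaussianMeasure α) := by
    intro f g
    rw [ContinuousLinearMap.comp_apply, ContinuousLinearMap.adjoint_inner_right, L2.inner_def]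
    exact integral_congr_ae (hprod f g).symm
  have hker : ∀ (f : harmonicFock α) (z : ℂ),
      (fun w => φ w * f.1 w * conj (harmonicKernel α z w)) =ᵐ[gaussianMeasure α]
        fun w => φ w * f.1 w * conj ((kernelVector hα z).1 w) := by
    intro f z
    filter_upwards [coeFn_kernelVector hα z] with w hw
    rw [hw]
  refine ⟨fun f z => ?_, fun f => ?_, fun f h => ?_⟩
  · exact (L2.integrable_inner (𝕜 := ℂ) (M (kernelVector hα z)) (M f)).congr
      ((hker f z).trans (hprod f _)).symm
  · refine (ae_eq_inner_kernelVector hα _).trans (Eventually.of_forall fun z => ?_)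
    simp only [hinner, projIntegral]
    exact integral_congr_ae (hker f z).symm
  · refine ext_inner_left ℂ fun g => ?_
    rw [hinner, Submodule.inner_orthogonalProjectionOnto_eq_of_mem_left, L2.inner_def]
    refine integral_congr_ae ?_
    filter_upwards [h.coeFn_toLp] with w hw
    rw [hw, RCLike.inner_apply]

end HarmonicFock

/-! ### The Schatten bound -/

theorem theorem4p3 (α : ℝ) (hα : 0 < α) (p : ℝ≥0∞) (hp : 1 ≤ p) (φ : ℂ → ℝ)
    (hφ0 : ∀ᵐ z ∂(volume : Measure ℂ), 0 ≤ φ z) (hφ : MemLp φ p (volume : Measure ℂ)) :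
    ∃ T : HarmonicFock.harmonicFock α →L[ℂ] HarmonicFock.harmonicFock α,
      HarmonicFock.IsToeplitz α φ T ∧
      Schatten.MemSchatten p T ∧
      (p ≠ ∞ → Schatten.schattenNorm p T ^ p.toReal ≤
        ENNReal.ofReal (2 * α / Real.pi) * ∫⁻ z : ℂ, ENNReal.ofReal (φ z) ^ p.toReal) ∧
      (p = ∞ → Schatten.schattenNorm ∞ T ≤ eLpNorm φ ∞ (volume : Measure ℂ)) := by
  open HarmonicFock in
  have hac := absolutelyContinuous_gaussianMeasure (α := α)
  have hφ0' : ∀ᵐ z ∂(gaussianMeasure α), 0 ≤ φ z := hac.ae_le hφ0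
  have hφm : AEStronglyMeasurable φ (gaussianMeasure α) := hφ.1.mono_ac hac
  rcases eq_or_ne p ∞ with rfl | hp'
  -- The measure `|f|² dλ` is absolutely continuous for area, so the essential supremum of `φ` for
  -- it is at most `‖φ‖_∞`.
  · obtain ⟨M, hM, -, hMA⟩ := exists_sqrt_mul_operator hφ0' hφm hφ.2.ne fun f hf =>
      (lintegral_mul_enorm_sq_le_eLpNorm (f := f.1) hf hφm le_top).trans
        (eLpNormEssSup_mono_measure φ ((withDensity_absolutelyContinuous _ _).trans hac))
    refine ⟨_, isToeplitz_adjoint_comp_self hα hφ0' hM, ?_, fun h => absurd rfl h, fun _ => ?_⟩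
    · simp [Schatten.MemSchatten, Schatten.schattenNorm]
    · rw [Schatten.schattenNorm, if_pos rfl, ← ofReal_norm,
        ContinuousLinearMap.norm_adjoint_comp_self, ← sq]
      exact hMA
  · have hp0 : p ≠ 0 := (zero_lt_one.trans_le hp).ne'
    have hpr : 0 < p.toReal := ENNReal.toReal_pos hp0 hp'
    set C := ENNReal.ofReal (2 * α / Real.pi) * ∫⁻ z, ‖φ z‖ₑ ^ p.toReal with hCdef
    have hC : C ≠ ∞ := ENNReal.mul_ne_top (by simp)
      ((eLpNorm_lt_top_iff_lintegral_rpow_enorm_lt_top hp0 hp').1 hφ.2).ne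
    have hsum : ∀ (n : ℕ) (e : Fin n → harmonicFock α), Orthonormal ℂ e →
        ∑ i, (∫⁻ z, ‖φ z‖ₑ * ‖(e i).1 z‖ₑ ^ 2 ∂(gaussianMeasure α)) ^ p.toReal ≤ C := by
      intro n e he
      refine le_trans (Finset.sum_le_sum fun i _ => ?_)
        (sum_lintegral_mul_enorm_sq_le hα (hφ.1.enorm.pow_const _) he)
      exact lintegral_mul_enorm_sq_rpow_le (he.1 i) hφm hp hp'
    -- The bound `C ^ (1/p)` on unit vectors is `hsum` for the family consisting of `f` alone.
    obtain ⟨M, hM, hMn, -⟩ := exists_sqrt_mul_operator hφ0' hφm (A := C ^ p.toReal⁻¹)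
      (ENNReal.rpow_ne_top_of_nonneg (by positivity) hC) fun f hf => by
        rw [ENNReal.le_rpow_inv_iff hpr]
        have := hsum 1 (fun _ => f) ⟨fun _ => hf, fun i j hij => absurd (Subsingleton.elim i j) hij⟩
        simpa using this
    have hMsum : ∀ (n : ℕ) (e : Fin n → harmonicFock α), Orthonormal ℂ e →
        ∑ i, ‖M (e i)‖ₑ ^ (2 * p.toReal) ≤ C := by
      intro n e he
      refine le_trans (le_of_eq (Finset.sum_congr rfl fun i _ => ?_)) (hsum n e he)
      rw [← hMn, ENNReal.rpow_mul, ENNReal.rpow_two]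
    have hMc : IsCompactOperator M := Schatten.isCompactOperator_of_sum_le (by positivity) hC hMsum
    have hTc : IsCompactOperator (ContinuousLinearMap.adjoint M ∘L M) :=
      hMc.clm_comp (ContinuousLinearMap.adjoint M)
    have htr := Schatten.tsum_singularMultiplicity_le hMsum
    refine ⟨_, isToeplitz_adjoint_comp_self hα hφ0' hM, ?_, fun _ => ?_, fun h => absurd h hp'⟩
    · rw [Schatten.MemSchatten, Schatten.schattenNorm, if_neg hp', if_pos hTc]
      exact ENNReal.rpow_lt_top_of_nonneg (by positivity) (htr.trans_lt hC.lt_top).ne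
    · rw [Schatten.schattenNorm, if_neg hp', if_pos hTc, one_div, ENNReal.rpow_inv_rpow hpr.ne']
      refine htr.trans (le_of_eq ?_)
      rw [hCdef]
      congr 1
      refine lintegral_congr_ae ?_
      filter_upwards [hφ0] with z hz
      rw [Real.enorm_of_nonneg hz]
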